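/- Let $E=(E^0,E^1,r,s)$ be a nonempty directed graph with countable vertex set $E^0$, countable edge set $E^1$, and no sinks (every vertex emits an edge). Assume that $E$ is locally finite: $s^{-1}(v)$ and $r^{-1}(v)$ are finite for every $v\in E^0$. Let $X$ be the space of infinite paths $x=x_1x_2\ldots$ in $E$ (so $s(x_{i+1})=r(x_i)$ for all $i$) with the topology generated by cylinder sets, and let $\sigma:X\to X$ be the one-sided shift; $(X,\sigma)$ is the Deaconu--Renault system of $E$, with $\sigma$ defined on all of $X$. *Metric entropy.* For a Deaconu--Renault system $(X,\sigma)$ (a local homeomorphism $\sigma$ defined on an open subset of a locally compact Hausdorff space $X$) and a metric $d$ on $X$, put $I_n(x)=\{0\le i<n: x\in Dom(\sigma^i)\}$ and $d_n(x,y)=\max_{i\in I_n(x)\cap I_n(y)}d(\sigma^i(x),\sigma^i(y))$. For $Y\subseteq X$ let $sep(n,\varepsilon,\sigma,Y)$ be the largest cardinality of a set $A\subseteq Y$ with $d_n(x,y)>\varepsilon$ for all distinct $x,y\in A$. For $K\subseteq X$ compact let $ssep(n,\varepsilon,\sigma,K)=\sup_F sep(n,\varepsilon,\sigma,K\cap F)$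 over all closed $F\subseteq Dom(\sigma^{n-1})$. The metric entropy is $$h_d(\sigma)=\sup_{K}\ \lim_{\varepsilon\to0}\ \limsup_{n\to\infty}\ \frac1n\log ssep(n,\varepsilon,\sigma,K),$$ the supremum being over all compact $K\subseteq X$. *The metric $d_X$.* Let $p_1,p_2,\ldots$ be an enumeration of the set $\mathfrak p$ of finite paths of $E$, where the paths of length $0$ are the finite nonempty sets $A$ of vertices, and such an $A$ is an initial segment of $x\in X$ when $s(x_1)\in A$. Then $d_X(x,x)=0$, and for $x\ne y$, $d_X(x,y)=2^{-i}$, where $i$ is the least index such that $p_i$ is an initial segment of exactly one of $x$ and $y$. *Gurevich entropy.* For a finite subgraph $H$ of $E$ let $X_H\subseteq X$ be the compact set of infinite paths in $H$, and let $h(X_H,\sigma)$ be the topological entropy of the shift on $X_H$ (equal to $0$ if $X_H=\emptyset$). Put $$h_G(E)=\sup\{h(X_H,\sigma): H\subseteq E \text{ a finite subgraph}\}\in[0,\infty].$$ Then, for every enumeration of $\mathfrak p$, $$h_{d_X}(\sigma)=h_G(E).$$ Moreover, for every injective numbering $h:E^1\to\{1,2,\ldots\}$ of the edges, $h_G(E)$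 is also the metric entropy $h_d(\sigma)$ of $(X,\sigma)$ with respect to Gurevich's metric $$d(x,y)=\sum_{i=1}^\infty \frac{1}{2^i}\left|\frac1{h(x_i)}-\frac1{h(y_i)}\right|.$$ -/

import Mathlib

namespace GraphEntropy

open Set Filter Topology

/-! ## Deaconu-Renault systems and their metric entropy -/

/-- A Deaconu-Renault system on `X`: a local homeomorphism `σ` defined on an open subset `dom` of
the locally compact Hausdorff space `X`. The values of `map` outside `dom` play no role. (The image
of `dom` is open because a local homeomorphism on an open set is an open map.) -/
structure DeaconuRenaultSystem (X : Type*) [TopologicalSpace X] where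
  t2 : T2Space X
  locallyCompact : LocallyCompactSpace X
  dom : Set X
  isOpen_dom : IsOpen dom
  map : X → X
  isLocalHomeomorphOn : IsLocalHomeomorphOn map dom

namespace DeaconuRenaultSystem

variable {X : Type*} [TopologicalSpace X] (S : DeaconuRenaultSystem X)

/-- `Dom(σⁿ)`: `Dom(σ⁰) = X` and `Dom(σⁿ⁺¹) = σ⁻¹(Dom(σⁿ))`. On `Dom(σⁿ)` the iterate `σⁿ` is
`S.map^[n]`. -/
def domIter : ℕ → Set X
  | 0 => univ
  | n + 1 => {x | x ∈ S.dom ∧ S.map x ∈ domIter n}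

/-- `I_n(x) = {i ∈ {0, …, n-1} : x ∈ Dom(σⁱ)}`. -/
def timeSet (n : ℕ) (x : X) : Set ℕ := {i | i < n ∧ x ∈ S.domIter i}

/-- `d_n(x,y) = max {d(σⁱ x, σⁱ y) : i ∈ I_n(x) ∩ I_n(y)}`; for `n ≥ 1` this is a supremum over a
finite nonempty set. -/
noncomputable def distIter (d : X → X → ℝ) (n : ℕ) (x y : X) : ℝ :=
  sSup ((fun i => d (S.map^[i] x) (S.map^[i] y)) '' (S.timeSet n x ∩ S.timeSet n y))

/-- `A` is an `(n, ε, σ, Y)`-separated set. -/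
def IsSep (d : X → X → ℝ) (n : ℕ) (ε : ℝ) (Y A : Set X) : Prop :=
  A ⊆ Y ∧ ∀ x ∈ A, ∀ y ∈ A, x ≠ y → ε < S.distIter d n x y

/-- `sep(n, ε, σ, Y)`: the largest cardinality of an `(n, ε, σ, Y)`-separated set. -/
noncomputable def sep (d : X → X → ℝ) (n : ℕ) (ε : ℝ) (Y : Set X) : ℕ∞ :=
  ⨆ (A : Set X) (_ : S.IsSep d n ε Y A), A.encard

/-- `ssep(n, ε, σ, K)`: the supremum of `sep(n, ε, σ, K ∩ F)` over the closed sets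
`F ⊆ Dom(σⁿ⁻¹)` (used for `n ≥ 1`). -/
noncomputable def ssep (d : X → X → ℝ) (n : ℕ) (ε : ℝ) (K : Set X) : ℕ∞ :=
  ⨆ (F : Set X) (_ : IsClosed F ∧ F ⊆ S.domIter (n - 1)), S.sep d n ε (K ∩ F)

/-- `h_ε(σ, K, d) = limsup (1/n) log ssep(n, ε, σ, K)`, an extended real number. -/
noncomputable def entropyAtScale (d : X → X → ℝ) (ε : ℝ) (K : Set X) : EReal :=
  limsup (fun n : ℕ => ENNReal.log (S.ssep d n ε K : ENNReal) / (n : EReal)) atTop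

/-- `h_d(σ, K)`: the limit of `h_ε(σ, K, d)` as `ε → 0`, which is the supremum over `ε > 0` because
`h_ε` increases as `ε` decreases. -/
noncomputable def entropyOn (d : X → X → ℝ) (K : Set X) : EReal :=
  ⨆ (ε : ℝ) (_ : 0 < ε), S.entropyAtScale d ε K

/-- The metric entropy `h_d(σ)` of the system with respect to a metric `d` on `X`: the supremum of
`h_d(σ, K)` over all compact sets `K ⊆ X`. -/
noncomputable def metricEntropy (d : X → X → ℝ) : EReal :=
  ⨆ (K : Set X) (_ : IsCompact K), S.entropyOn d K

end DeaconuRenaultSystem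

/-! ## Graphs and their edge shifts -/

/-- A directed graph with vertex set `V`, edge set `Ed`, and source and range maps `s`, `r`. -/
structure DiGraph (V Ed : Type*) where
  s : Ed → V
  r : Ed → V

namespace DiGraph

variable {V Ed : Type*} (E : DiGraph V Ed)

def NoSinks : Prop := ∀ v, ∃ e, E.s e = v

def RowFinite : Prop := ∀ v, {e | E.s e = v}.Finite

def LocallyFinite : Prop := E.RowFinite ∧ ∀ v, {e | E.r e = v}.Finite

/-- The infinite paths `e₀e₁e₂…`, with `s(eᵢ₊₁) = r(eᵢ)`. -/
@[ext]
structure InfPath where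
  edge : ℕ → Ed
  chain : ∀ i, E.s (edge (i + 1)) = E.r (edge i)

/-- Infinite paths carry the uniformity, and hence the topology, of a subspace of the product of
discrete spaces `Ed^ℕ`; a basis of the topology is given by the cylinder sets. -/
instance : UniformSpace E.InfPath :=
  UniformSpace.comap InfPath.edge (@Pi.uniformSpace ℕ (fun _ => Ed) (fun _ => ⊥))

/-- The one-sided shift map. -/
def shift (x : E.InfPath) : E.InfPath := ⟨fun i => x.edge (i + 1), fun i => x.chain (i + 1)⟩

/-- The set `𝔭` of finite paths, in the convention for ultragraphs: the paths of positive length are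
the finite nonempty edge paths, and the paths of length `0` are the members of the smallest family of
sets of vertices that contains all singletons and is closed under finite unions and nonempty
intersections, that is, the finite nonempty sets of vertices. -/
inductive FinPath : Type _
  | ofVertices (A : Finset V) (hA : A.Nonempty)
  | ofEdges (l : List Ed) (hne : l ≠ []) (hl : l.IsChain fun e f => E.s f = E.r e)

/-- The infinite path `x` has the finite path `p` as an initial segment. -/
def IsInitial : E.FinPath → E.InfPath → Prop
  | .ofVertices A _, x => E.s (x.edge 0) ∈ A
  | .ofEdges l _ _, x => ∀ (i : ℕ) (hi : i < l.length), l[i] = x.edge i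

open Classical in
/-- The metric `d_X` given by an enumeration of the finite paths: `d_X(x,y) = 1/2^i`, where the
`i`-th path (counting from `1`) is the first one that is an initial segment of exactly one of `x`
and `y`, and `d_X(x,x) = 0`. -/
noncomputable def pathDist (p : ℕ ≃ E.FinPath) (x y : E.InfPath) : ℝ :=
  if x = y then 0
  else 1 / 2 ^ (sInf {i : ℕ | Xor (E.IsInitial (p i) x) (E.IsInitial (p i) y)} + 1)

/-- Gurevich's metric `∑_{i ≥ 1} 2^{-i} |1/h(xᵢ) - 1/h(yᵢ)|` given by an enumeration of the edges;
the edge `e` has the number `h e + 1`. -/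
noncomputable def gurevichDist (h : Ed ↪ ℕ) (x y : E.InfPath) : ℝ :=
  ∑' i : ℕ, |1 / ((h (x.edge i) : ℝ) + 1) - 1 / ((h (y.edge i) : ℝ) + 1)| / 2 ^ (i + 1)

/-- A finite subgraph of `E`. -/
structure FiniteSubgraph where
  verts : Finset V
  edges : Finset Ed
  s_mem : ∀ e ∈ edges, E.s e ∈ verts
  r_mem : ∀ e ∈ edges, E.r e ∈ verts

/-- `X_H`: the infinite paths in the finite subgraph `H`. -/
def subshift (H : E.FiniteSubgraph) : Set E.InfPath := {x | ∀ i, x.edge i ∈ H.edges}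

open Classical in
/-- The topological entropy `h(X_H, σ)` of the compact shift `X_H`; the empty shift has
entropy `0`. -/
noncomputable def subshiftEntropy (H : E.FiniteSubgraph) : EReal :=
  if (E.subshift H).Nonempty then Dynamics.coverEntropy E.shift (E.subshift H) else 0

/-- The Gurevich entropy `h_G(E)`: the supremum of the entropies of the finite subgraphs. -/
noncomputable def gurevichEntropy : EReal := ⨆ H : E.FiniteSubgraph, E.subshiftEntropy H

/-! ### The edge shift of a row-finite graph is a Deaconu-Renault system -/

theorem continuous_coord (i : ℕ) : @Continuous E.InfPath Ed _ ⊥ (fun x => x.edge i) := by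
  let _ : TopologicalSpace Ed := ⊥
  have h : Continuous (InfPath.edge : E.InfPath → ℕ → Ed) := continuous_induced_dom
  exact (continuous_apply i).comp h

theorem continuous_of_coord {Y : Type*} [TopologicalSpace Y] {f : Y → E.InfPath}
    (h : ∀ i, @Continuous Y Ed _ ⊥ (fun y => (f y).1 i)) : Continuous f := by
  let _ : TopologicalSpace Ed := ⊥
  exact continuous_induced_rng.2 (continuous_pi h)

theorem isOpen_coord (i : ℕ) (T : Set Ed) : IsOpen {x : E.InfPath | x.edge i ∈ T} := by
  let _ : TopologicalSpace Ed := ⊥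
  have : DiscreteTopology Ed := ⟨rfl⟩
  exact (isOpen_discrete T).preimage (E.continuous_coord i)

theorem continuous_shift : Continuous E.shift :=
  E.continuous_of_coord fun i => E.continuous_coord (i + 1)

theorem t2Space_infPath : T2Space E.InfPath := by
  let _ : TopologicalSpace Ed := ⊥
  have : DiscreteTopology Ed := ⟨rfl⟩
  exact T2Space.of_injective_continuous (f := (InfPath.edge : E.InfPath → ℕ → Ed))
    (fun _ _ h => InfPath.ext h) continuous_induced_dom

variable {E}

theorem isCompact_source (hE : E.RowFinite) (v : V) :
    IsCompact {x : E.InfPath | E.s (x.edge 0) = v} := by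
  let _ : TopologicalSpace Ed := ⊥
  have : DiscreteTopology Ed := ⟨rfl⟩
  let T : ℕ → Set Ed := fun n =>
    Nat.rec {e | E.s e = v} (fun _ t => ⋃ f ∈ t, {e | E.s e = E.r f}) n
  have hT : ∀ n, (T n).Finite := by
    intro n
    induction n with
    | zero => exact hE v
    | succ n ih => exact ih.biUnion fun f _ => hE (E.r f)
  have hind : IsInducing (InfPath.edge : E.InfPath → ℕ → Ed) := ⟨rfl⟩
  rw [hind.isCompact_iff]
  have hset : InfPath.edge '' {x : E.InfPath | E.s (x.edge 0) = v} =
      Set.pi univ T ∩ ⋂ i : ℕ, {x : ℕ → Ed | E.s (x (i + 1)) = E.r (x i)} := by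
    ext x
    simp only [mem_image, mem_ofPred_eq, mem_inter_iff, Set.mem_pi, mem_univ, true_implies,
      mem_iInter]
    constructor
    · rintro ⟨y, hy, rfl⟩
      refine ⟨fun i => ?_, y.2⟩
      induction i with
      | zero => exact hy
      | succ i ih => exact mem_biUnion ih (y.2 i)
    · rintro ⟨h1, h2⟩
      exact ⟨⟨x, h2⟩, h1 0, rfl⟩
  rw [hset]
  refine (isCompact_univ_pi fun i => (hT i).isCompact).inter_right (isClosed_iInter fun i => ?_)
  have hc : Continuous fun x : ℕ → Ed => (x (i + 1), x i) :=
    (continuous_apply (i + 1)).prodMk (continuous_apply i)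
  exact (isClosed_discrete {q : Ed × Ed | E.s q.1 = E.r q.2}).preimage hc

theorem locallyCompactSpace_infPath (hE : E.RowFinite) : LocallyCompactSpace E.InfPath := by
  have := E.t2Space_infPath
  have : WeaklyLocallyCompactSpace E.InfPath := ⟨fun x =>
    ⟨_, isCompact_source hE (E.s (x.edge 0)),
      (E.isOpen_coord 0 {e | E.s e = E.s (x.edge 0)}).mem_nhds rfl⟩⟩
  infer_instance

variable (E)

/-- Put the edge `e` in front of `y` where this gives a path. -/
noncomputable def cons (e : Ed) (z y : E.InfPath) : E.InfPath :=
  open Classical in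
  if h : E.s (y.edge 0) = E.r e then
    ⟨fun i => Nat.casesOn i e y.1, fun i => by cases i with
      | zero => exact h
      | succ i => exact y.2 i⟩
  else z

theorem isLocalHomeomorph_shift : IsLocalHomeomorph E.shift := by
  intro x
  let e := x.edge 0
  have hcons : ∀ y, E.s (y.edge 0) = E.r e →
      (E.cons e x y).1 0 = e ∧ ∀ i, (E.cons e x y).1 (i + 1) = y.edge i := by
    intro y hy
    simp [cons, hy]
  have htgt : IsOpen {y : E.InfPath | E.s (y.edge 0) = E.r e} :=
    E.isOpen_coord 0 {f | E.s f = E.r e}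
  refine ⟨{ toFun := E.shift
            invFun := E.cons e x
            source := {y | y.edge 0 = e}
            target := {y | E.s (y.edge 0) = E.r e}
            map_source' := ?_
            map_target' := fun y hy => (hcons y hy).1
            left_inv' := ?_
            right_inv' := fun y hy => InfPath.ext (funext fun i => (hcons y hy).2 i)
            open_source := E.isOpen_coord 0 {e}
            open_target := htgt
            continuousOn_toFun := E.continuous_shift.continuousOn
            continuousOn_invFun := ?_ }, rfl, rfl⟩
  · intro y hy
    have h := y.2 0
    rw [show y.edge 0 = e from hy] at h
    exact h
  · intro y hy
    have h : E.s ((E.shift y).1 0) = E.r e := by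
      have h := y.2 0
      rw [show y.edge 0 = e from hy] at h
      exact h
    refine InfPath.ext (funext fun i => ?_)
    cases i with
    | zero => exact (hcons _ h).1.trans hy.symm
    | succ i => exact (hcons _ h).2 i
  · rw [continuousOn_iff_continuous_domRestrict]
    refine E.continuous_of_coord fun i => ?_
    let _ : TopologicalSpace Ed := ⊥
    cases i with
    | zero =>
      refine continuous_const.congr (f := fun _ => e) fun y => ?_
      exact (hcons y.1 y.2).1.symm
    | succ i =>
      refine ((E.continuous_coord i).comp continuous_subtype_val).congr fun y => ?_
      exact ((hcons y.1 y.2).2 i).symm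

/-- The Deaconu-Renault system of a row-finite graph: the one-sided shift, defined everywhere on the
space of infinite paths. -/
def edgeShift (hE : E.RowFinite) : DeaconuRenaultSystem E.InfPath where
  t2 := E.t2Space_infPath
  locallyCompact := locallyCompactSpace_infPath hE
  dom := univ
  isOpen_dom := isOpen_univ
  map := E.shift
  isLocalHomeomorphOn := E.isLocalHomeomorph_shift.isLocalHomeomorphOn

end DiGraph

end GraphEntropy

namespace GraphEntropy

open Set Filter Topology Uniformity

namespace DiGraph

variable {V Ed : Type*} {E : DiGraph V Ed}

/-! Each of the two metrics has two properties, `SeparatesPrefixes` and `NamesControl`, and any `d`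
having both has metric entropy equal to the Gurevich entropy.

Lower bound, from `SeparatesPrefixes`: inside a finite subgraph, paths that differ early are a
definite distance apart, so a dynamical net of the compact set `E.subshift H` is an `(n,
ε)`-separated set.

Upper bound, from `NamesControl`: up to `ε`, the metric sees of a path only its name relative to a
finite vertex set `W`, that is, the edges leaving `W` and their times; what happens outside `W` is
blank. So an `(n, ε)`-separated set injects into the names of length `n + L`, and names, unlike
paths, can be counted (`card_image_name_le`). Cut a path at its first visit to `W`, say at `u`, and
at its last visit to `u`: the name is a blank, a loop name at `u`, one edge, and a name relative to
`W` without `u`. By induction on the size of `W`, each vertex costs only a polynomial factor,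
provided that loops of length `n` at a vertex have at most `exp (c * n)` names, where `c` is the
Gurevich entropy.

That last bound is exact for every `n` (`log_card_loops_le`): finitely many loops of length `n` at
`u`, one chosen for each name, lie in a finite subgraph, and they can be concatenated freely, so the
logarithm of their number is at most `n` times the entropy of that subgraph. -/

theorem shift_iterate_edge (x : E.InfPath) (k i : ℕ) :
    (E.shift^[k] x).edge i = x.edge (k + i) := by
  induction k generalizing x with
  | zero => simp
  | succ k ih =>
    rw [Function.iterate_succ_apply, ih]
    exact congrArg x.edge (by omega)

/-! ### The uniformity, and compactness of the finite subshifts -/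

variable (E) in
/-- The pairs of paths that agree in their first `n` edges. -/
def agree (n : ℕ) : Set (E.InfPath × E.InfPath) := {q | ∀ i < n, q.1.edge i = q.2.edge i}

theorem uniformity_eq :
    𝓤 E.InfPath = ⨅ i : ℕ, 𝓟 {q : E.InfPath × E.InfPath | q.1.edge i = q.2.edge i} := by
  let _ : UniformSpace Ed := ⊥
  change comap _ (𝓤 (ℕ → Ed)) = _
  rw [Pi.uniformity, Filter.comap_iInf]
  refine iInf_congr fun i => ?_
  rw [Filter.comap_comap, show 𝓤 Ed = 𝓟 SetRel.id from rfl, comap_principal]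
  rfl

theorem agree_mem_uniformity (n : ℕ) : E.agree n ∈ 𝓤 E.InfPath := by
  have h : E.agree n = ⋂ i ∈ Finset.range n, {q : E.InfPath × E.InfPath | q.1.edge i = q.2.edge i} := by
    ext q
    simp [agree]
  rw [h, Filter.biInter_finset_mem, uniformity_eq]
  exact fun i _ => mem_iInf_of_mem i (mem_principal_self _)

theorem exists_agree_subset {U : Set (E.InfPath × E.InfPath)} (hU : U ∈ 𝓤 E.InfPath) :
    ∃ n, E.agree n ⊆ U := by
  rw [uniformity_eq, mem_iInf] at hU
  obtain ⟨I, hI, W, hW, rfl⟩ := hU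
  obtain ⟨n, hn⟩ := hI.bddAbove
  refine ⟨n + 1, fun q hq => mem_iInter.2 fun i => hW i ?_⟩
  exact hq i (Nat.lt_succ_of_le (hn i.2))

theorem isClosed_subshift (H : E.FiniteSubgraph) : IsClosed (E.subshift H) := by
  have h : E.subshift H = ⋂ i : ℕ, {x : E.InfPath | x.edge i ∈ (H.edges : Set Ed)ᶜ}ᶜ := by
    ext x
    simp [subshift]
  rw [h]
  exact isClosed_iInter fun i => (E.isOpen_coord i _).isClosed_compl

theorem isCompact_subshift (hE : E.RowFinite) (H : E.FiniteSubgraph) :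
    IsCompact (E.subshift H) := by
  refine (H.verts.isCompact_biUnion fun v _ => isCompact_source hE v).of_isClosed_subset
    (isClosed_subshift H) fun x hx => ?_
  simpa using H.s_mem _ (hx 0)

theorem exists_infPath [Nonempty V] (hsink : E.NoSinks) : Nonempty E.InfPath := by
  choose f hf using hsink
  obtain ⟨v⟩ := ‹Nonempty V›
  refine ⟨⟨fun n => Nat.rec (f v) (fun _ e => f (E.r e)) n, fun i => hf _⟩⟩

/-! ### Dynamical distances of the edge shift -/

section EdgeShift

variable (hE : E.RowFinite)

theorem domIter_edgeShift (n : ℕ) : (E.edgeShift hE).domIter n = univ := by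
  induction n with
  | zero => rfl
  | succ n ih =>
    rw [DeaconuRenaultSystem.domIter, ih]
    simp [edgeShift]

theorem timeSet_edgeShift (n : ℕ) (x : E.InfPath) :
    (E.edgeShift hE).timeSet n x = {i | i < n} := by
  simp [DeaconuRenaultSystem.timeSet, domIter_edgeShift]

theorem distIter_edgeShift (d : E.InfPath → E.InfPath → ℝ) (n : ℕ) (x y : E.InfPath) :
    (E.edgeShift hE).distIter d n x y =
      sSup ((fun i => d (E.shift^[i] x) (E.shift^[i] y)) '' {i | i < n}) := by
  rw [DeaconuRenaultSystem.distIter, timeSet_edgeShift, timeSet_edgeShift, inter_self]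
  rfl

/-- The maximum is attained at some time. Nonnegativity of `ε` covers `n = 0`, where the supremum of
the empty set is `0`. -/
theorem lt_distIter_iff {d : E.InfPath → E.InfPath → ℝ} {ε : ℝ} (hε : 0 ≤ ε) (n : ℕ)
    (x y : E.InfPath) :
    ε < (E.edgeShift hE).distIter d n x y ↔ ∃ i < n, ε < d (E.shift^[i] x) (E.shift^[i] y) := by
  rw [distIter_edgeShift]
  constructor
  · intro h
    by_contra! hcon
    refine h.not_ge (Real.sSup_le ?_ hε)
    rintro _ ⟨i, hi, rfl⟩
    exact hcon i hi
  · rintro ⟨i, hi, h⟩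
    exact h.trans_le (le_csSup ((finite_lt_nat n).image _).bddAbove ⟨i, hi, rfl⟩)

/-- The shift is defined everywhere, so `F = univ` is among the admissible closed sets. -/
theorem ssep_edgeShift (d : E.InfPath → E.InfPath → ℝ) (n : ℕ) (ε : ℝ) (K : Set E.InfPath) :
    (E.edgeShift hE).ssep d n ε K = (E.edgeShift hE).sep d n ε K := by
  refine le_antisymm (iSup₂_le fun F _ => ?_) ?_
  · refine iSup₂_le fun A hA => le_iSup₂_of_le A ⟨hA.1.trans inter_subset_left, hA.2⟩ le_rfl
  · refine le_iSup₂_of_le univ ⟨isClosed_univ, ?_⟩ (by rw [inter_univ])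
    rw [domIter_edgeShift]

/-! ### The lower bound -/

/-- On each finite subshift, paths that differ early are uniformly far apart. -/
def SeparatesPrefixes (E : DiGraph V Ed) (d : E.InfPath → E.InfPath → ℝ) : Prop :=
  ∀ (H : E.FiniteSubgraph) (L : ℕ), ∃ ε > 0, ∀ x ∈ E.subshift H, ∀ y ∈ E.subshift H,
    (∃ i < L, x.edge i ≠ y.edge i) → ε < d x y

theorem shift_iterate_mem_subshift {H : E.FiniteSubgraph} {x : E.InfPath} (hx : x ∈ E.subshift H)
    (k : ℕ) : E.shift^[k] x ∈ E.subshift H := fun i => by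
  rw [shift_iterate_edge]
  exact hx _

theorem coverEntropy_subshift_le {d : E.InfPath → E.InfPath → ℝ} (hd : E.SeparatesPrefixes d)
    (H : E.FiniteSubgraph) :
    Dynamics.coverEntropy E.shift (E.subshift H) ≤ (E.edgeShift hE).metricEntropy d := by
  rw [Dynamics.coverEntropy_eq_iSup_netEntropyEntourage]
  refine iSup₂_le fun U hU => ?_
  obtain ⟨L, hL⟩ := exists_agree_subset hU
  obtain ⟨ε, hε, hsep⟩ := hd H L
  refine le_iSup₂_of_le (E.subshift H) (isCompact_subshift hE H) (le_iSup₂_of_le ε hε ?_)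
  have hrefl : ∀ x, (x, x) ∈ U := fun x => refl_mem_uniformity hU
  refine limsup_le_limsup (Eventually.of_forall fun n => ?_)
  refine EReal.div_le_div_right_of_nonneg (by positivity) (ENNReal.log_monotone ?_)
  refine ENat.toENNReal_mono ?_
  rw [ssep_edgeShift]
  refine iSup₂_le fun s hs => ?_
  rw [← Set.encard_coe_eq_coe_finsetCard]
  refine le_iSup₂_of_le (s : Set E.InfPath) ⟨hs.1, fun x hx y hy hxy => ?_⟩ le_rfl
  rw [lt_distIter_iff hE hε.le]
  -- A dynamical net has disjoint dynamical balls. Each ball contains its centre, so distinct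
  -- centres are not `U`-close at some time before `n`.
  have hdisj := hs.2 hx hy hxy
  have hy' : (x, y) ∉ Dynamics.dynEntourage E.shift U n := fun hmem => by
    refine (Set.disjoint_left.1 hdisj : ∀ ⦃z⦄, _ → z ∉ _) hmem ?_
    exact Dynamics.mem_dynEntourage.2 fun k _ => hrefl _
  rw [Dynamics.mem_dynEntourage] at hy'
  push Not at hy'
  obtain ⟨i, hi, hiU⟩ := hy'
  refine ⟨i, hi, hsep _ (shift_iterate_mem_subshift (hs.1 hx) i) _
    (shift_iterate_mem_subshift (hs.1 hy) i) ?_⟩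
  by_contra! hcon
  exact hiU (hL hcon)

theorem metricEntropy_nonneg [Nonempty E.InfPath] (d : E.InfPath → E.InfPath → ℝ) :
    0 ≤ (E.edgeShift hE).metricEntropy d := by
  obtain ⟨x⟩ := ‹Nonempty E.InfPath›
  refine le_iSup₂_of_le {x} isCompact_singleton (le_iSup₂_of_le 1 one_pos ?_)
  refine le_limsup_of_frequently_le (Frequently.of_forall fun n => ?_)
  refine EReal.div_nonneg ?_ (by positivity)
  rw [ENNReal.zero_le_log_iff, ssep_edgeShift]
  have h : (1 : ℕ∞) ≤ (E.edgeShift hE).sep d n 1 {x} := by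
    refine le_iSup₂_of_le {x} ⟨subset_rfl, ?_⟩ (by simp)
    rintro _ rfl _ rfl h
    exact absurd rfl h
  exact_mod_cast ENat.toENNReal_mono h

theorem gurevichEntropy_le_metricEntropy [Nonempty E.InfPath] {d : E.InfPath → E.InfPath → ℝ}
    (hd : E.SeparatesPrefixes d) : E.gurevichEntropy ≤ (E.edgeShift hE).metricEntropy d := by
  refine iSup_le fun H => ?_
  rw [subshiftEntropy]
  split_ifs
  · exact coverEntropy_subshift_le hE hd H
  · exact metricEntropy_nonneg hE d

end EdgeShift

theorem gurevichEntropy_nonneg : 0 ≤ E.gurevichEntropy := by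
  refine le_iSup_of_le ⟨∅, ∅, by simp, by simp⟩ ?_
  rw [subshiftEntropy, if_neg]
  rintro ⟨x, hx⟩
  simpa using hx 0

/-! ### Loops -/

/-- The concatenation of a sequence of loops of length `n` at `u`; the loops are given as initial
segments of infinite paths. -/
def glue {n : ℕ} (hn : 0 < n) {u : V} (w : ℕ → E.InfPath)
    (hw : ∀ j, E.s ((w j).edge 0) = u ∧ E.s ((w j).edge n) = u) : E.InfPath where
  edge i := (w (i / n)).edge (i % n)
  chain i := by
    have hlt := Nat.mod_lt i hn
    rcases Nat.lt_or_ge (i % n + 1) n with h | h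
    · have hdm := Nat.div_add_mod i n
      have h1 : (i + 1) / n = i / n := by
        rw [Nat.div_eq_iff hn]
        constructor
        · rw [mul_comm]; exact (Nat.mul_div_le i n).trans i.le_succ
        · rw [Nat.le_sub_one_iff_lt (by positivity)]
          nlinarith
      have h2 : (i + 1) % n = i % n + 1 := by
        have := Nat.div_add_mod (i + 1) n
        rw [h1] at this
        omega
      rw [h1, h2]
      exact (w _).chain _
    · have h2 : (i + 1) % n = 0 := by
        rw [Nat.add_mod]
        rcases Nat.lt_or_ge 1 n with h1 | h1
        · rw [Nat.mod_eq_of_lt h1, show i % n + 1 = n by omega, Nat.mod_self]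
        · rw [show n = 1 by omega, Nat.mod_one]
      rw [h2, (hw _).1, ← (w _).chain, show i % n + 1 = n by omega, (hw _).2]

theorem glue_edge {n : ℕ} (hn : 0 < n) {u : V} (w : ℕ → E.InfPath)
    (hw : ∀ j, E.s ((w j).edge 0) = u ∧ E.s ((w j).edge n) = u) (j : ℕ) {i : ℕ} (hi : i < n) :
    (glue hn w hw).edge (n * j + i) = (w j).edge i := by
  change (w ((n * j + i) / n)).edge ((n * j + i) % n) = _
  rw [Nat.mul_add_mod, Nat.mod_eq_of_lt hi, Nat.mul_add_div hn, Nat.div_eq_of_lt hi, add_zero]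

/-- All words in the loops of `T` are realised in one finite subgraph, so there are `T.card ^ k`
paths distinguished by their first `n * k` edges. -/
theorem log_card_loops_le {n : ℕ} (hn : 0 < n) {u : V} (T : Finset E.InfPath)
    (hT : ∀ x ∈ T, E.s (x.edge 0) = u ∧ E.s (x.edge n) = u)
    (hinj : ∀ x ∈ T, ∀ y ∈ T, (∀ i < n, x.edge i = y.edge i) → x = y) :
    ENNReal.log (T.card : ENNReal) / (n : EReal) ≤ E.gurevichEntropy := by
  classical
  rcases T.eq_empty_or_nonempty with rfl | ⟨x₀, hx₀⟩
  · rw [Finset.card_empty, Nat.cast_zero, ENNReal.log_zero, EReal.bot_div_of_pos_ne_top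
      (by exact_mod_cast hn) (EReal.natCast_ne_top n)]
    exact bot_le
  let edges : Finset Ed := T.biUnion fun x => (Finset.range n).image x.edge
  let H : E.FiniteSubgraph :=
    { verts := edges.image E.s ∪ edges.image E.r
      edges := edges
      s_mem := fun e he => Finset.mem_union_left _ (Finset.mem_image_of_mem _ he)
      r_mem := fun e he => Finset.mem_union_right _ (Finset.mem_image_of_mem _ he) }
  -- After its `k` chosen loops the path repeats the loop `x₀` forever, only to be infinite.
  let seq (k : ℕ) (f : Fin k → T) (j : ℕ) : T := if h : j < k then f ⟨j, h⟩ else ⟨x₀, hx₀⟩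
  let g (k : ℕ) (f : Fin k → T) : E.InfPath :=
    glue hn (fun j => (seq k f j : E.InfPath)) fun j => hT _ (seq k f j).2
  have hgH : ∀ k f, g k f ∈ E.subshift H := fun k f i =>
    Finset.mem_biUnion.2 ⟨_, (seq k f (i / n)).2,
      Finset.mem_image_of_mem _ (Finset.mem_range.2 (Nat.mod_lt i hn))⟩
  have hg : ∀ k f f', (∀ i < n * k, (g k f).edge i = (g k f').edge i) → f = f' := by
    intro k f f' h
    funext j
    have hseq : ∀ f'' : Fin k → T, seq k f'' j = f'' j := fun f'' => by simp [seq]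
    refine Subtype.ext (hinj _ (f j).2 _ (f' j).2 fun i hi => ?_)
    have := h (n * j + i) (by
      have : n * (j + 1) ≤ n * k := Nat.mul_le_mul_left _ j.2
      rw [mul_add] at this
      omega)
    rwa [glue_edge hn _ _ j hi, glue_edge hn _ _ j hi, hseq, hseq] at this
  have hcard : ∀ k : ℕ, ((T.card ^ k : ℕ) : ℕ∞) ≤
      Dynamics.netMaxcard E.shift (E.subshift H) (E.agree 1) (n * k) := by
    intro k
    have hinj' : Function.Injective (g k) := fun f f' h => hg k f f' fun i _ => by rw [h]
    have hnet : Dynamics.IsDynNetIn E.shift (E.subshift H) (E.agree 1) (n * k)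
        ((Finset.univ.image (g k) : Finset E.InfPath) : Set E.InfPath) := by
      refine ⟨?_, ?_⟩
      · intro x hx
        obtain ⟨f, -, rfl⟩ := Finset.mem_image.1 hx
        exact hgH k f
      · intro x hx y hy hxy
        obtain ⟨f, -, rfl⟩ := Finset.mem_image.1 hx
        obtain ⟨f', -, rfl⟩ := Finset.mem_image.1 hy
        -- `E.agree 1` is an equivalence relation, so two balls with a common point `z` have centres
        -- that agree at all times before `n * k`.
        refine Set.disjoint_left.2 fun z hz hz' => hxy ?_
        rw [hg k f f' fun i hi => ?_]
        have h1 := Dynamics.mem_dynEntourage.1 hz i hi 0 one_pos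
        have h2 := Dynamics.mem_dynEntourage.1 hz' i hi 0 one_pos
        simp only [shift_iterate_edge, add_zero] at h1 h2
        exact h1.trans h2.symm
    have := hnet.card_le_netMaxcard
    rwa [Finset.card_image_of_injective _ hinj', Finset.card_univ, Fintype.card_fun,
      Fintype.card_coe, Fintype.card_fin] at this
  refine le_iSup_of_le H ?_
  rw [subshiftEntropy, if_pos ⟨_, hgH 0 fun i => i.elim0⟩]
  refine le_trans ?_ (Dynamics.netEntropyEntourage_le_coverEntropy E.shift (E.subshift H)
    (agree_mem_uniformity 1))
  -- The bound on the limsup is needed only along the multiples `n * (N + 1)`, where it holds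
  -- exactly.
  refine le_limsup_of_frequently_le (frequently_atTop.2 fun N => ⟨n * (N + 1), ?_, ?_⟩)
  · nlinarith
  · have hN : ENNReal.log (T.card : ENNReal) / (n : EReal) =
        ENNReal.log ((T.card : ENNReal) ^ (N + 1)) / ((n * (N + 1) : ℕ) : EReal) := by
      rw [ENNReal.log_pow, EReal.natCast_mul, mul_comm ((N + 1 : ℕ) : EReal),
        EReal.mul_div_mul_cancel (EReal.natCast_ne_bot _) (EReal.natCast_ne_top _)]
      exact_mod_cast N.succ_ne_zero
    rw [hN]
    refine EReal.div_le_div_right_of_nonneg (by positivity) (ENNReal.log_monotone ?_)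
    simpa using ENat.toENNReal_mono (hcard (N + 1))

/-! ### Names of paths relative to a finite set of vertices -/

open Classical in
/-- The `W`-name of length `n` of a path: the edges with source in `W`, at their times before `n`;
all other times are blank. -/
noncomputable def name (W : Finset V) (n : ℕ) (x : E.InfPath) (i : ℕ) : Option Ed :=
  if i < n ∧ E.s (x.edge i) ∈ W then some (x.edge i) else none

/-- A loop name on `[a, b)`, the edge `e` at time `b`, and a name from time `b + 1` on. -/
def splice (a b : ℕ) (e : Ed) (w v : ℕ → Option Ed) (i : ℕ) : Option Ed :=
  if i < a then none else if i < b then w (i - a) else if i = b then some e else v (i - (b + 1))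

theorem edge_eq_of_name_eq {W : Finset V} {n i : ℕ} {x y : E.InfPath}
    (h : name W n x = name W n y) (hi : i < n) (hx : E.s (x.edge i) ∈ W) :
    y.edge i = x.edge i := by
  have := congrFun h i
  rw [name, if_pos ⟨hi, hx⟩, name] at this
  split_ifs at this
  exact (Option.some.inj this).symm

theorem name_of_mem {W : Finset V} {n i : ℕ} {x : E.InfPath} (hi : i < n)
    (hx : E.s (x.edge i) ∈ W) : name W n x i = some (x.edge i) := if_pos ⟨hi, hx⟩

theorem name_of_notMem {W : Finset V} {n i : ℕ} {x : E.InfPath}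
    (hx : E.s (x.edge i) ∉ W) : name W n x i = none := if_neg fun h => hx h.2

theorem name_of_le {W : Finset V} {n i : ℕ} {x : E.InfPath} (hi : n ≤ i) :
    name W n x i = none := if_neg fun h => hi.not_gt h.1

theorem name_congr {W W' : Finset V} {n n' i j : ℕ} {x y : E.InfPath} (he : x.edge i = y.edge j)
    (h : i < n ∧ E.s (x.edge i) ∈ W ↔ j < n' ∧ E.s (y.edge j) ∈ W') :
    name W n x i = name W' n' y j := by
  by_cases hx : i < n ∧ E.s (x.edge i) ∈ W
  · rw [name, if_pos hx, name, if_pos (h.1 hx), he]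
  · rw [name, if_neg hx, name, if_neg (mt h.2 hx)]

theorem name_eq_of_edge_eq (W : Finset V) {n : ℕ} {x y : E.InfPath}
    (h : ∀ i < n, x.edge i = y.edge i) : name W n x = name W n y := by
  funext i
  by_cases hi : i < n
  · exact name_congr (h i hi) (by rw [h i hi])
  · rw [name_of_le (not_lt.1 hi), name_of_le (not_lt.1 hi)]

/-- A recorded edge is common to both paths, so whether its source lies in the smaller set is
decided for both at once. -/
theorem name_eq_mono {W W' : Finset V} {n n' : ℕ} (hW : W ⊆ W') (hn : n ≤ n') {x y : E.InfPath}
    (h : name W' n' x = name W' n' y) : name W n x = name W n y := by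
  funext i
  by_cases hi : i < n
  · by_cases hx : E.s (x.edge i) ∈ W
    · have he := edge_eq_of_name_eq h (hi.trans_le hn) (hW hx)
      exact name_congr he.symm (by rw [he])
    · by_cases hy : E.s (y.edge i) ∈ W
      · have he := edge_eq_of_name_eq h.symm (hi.trans_le hn) (hW hy)
        exact name_congr he (by rw [he])
      · rw [name_of_notMem hx, name_of_notMem hy]
  · rw [name_of_le (not_lt.1 hi), name_of_le (not_lt.1 hi)]

theorem name_shift_apply {W : Finset V} {n m k i j : ℕ} (x : E.InfPath) (hj : k + i = j)
    (h : i < m ↔ j < n) : name W m (E.shift^[k] x) i = name W n x j := by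
  have he := shift_iterate_edge x k i
  rw [hj] at he
  exact name_congr he (by rw [he, h])

theorem name_shift_eq {W : Finset V} {n L k : ℕ} (hk : k < n) {x y : E.InfPath}
    (h : name W (n + L) x = name W (n + L) y) :
    name W L (E.shift^[k] x) = name W L (E.shift^[k] y) := by
  have h' : name W (k + L) x = name W (k + L) y := name_eq_mono subset_rfl (by omega) h
  funext i
  rw [name_shift_apply x rfl (by omega : i < L ↔ k + i < k + L), h',
    ← name_shift_apply y rfl (by omega : i < L ↔ k + i < k + L)]

open Classical in
-- Here `a` is the first time before `n` at which the path is in `W`, and `b` the last time before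
-- `n` at which it is at that same vertex. Between `b` and `n` the vertex does not recur, so erasing
-- it from `W` loses nothing.
theorem name_eq_blank_or_splice (W : Finset V) (n : ℕ) (x : E.InfPath) :
    name W n x = (fun _ => none) ∨ ∃ a b, a ≤ b ∧ b < n ∧ E.s (x.edge a) ∈ W ∧
      E.s (x.edge b) = E.s (x.edge a) ∧
      name W n x = splice a b (x.edge b) (name W (b - a) (E.shift^[a] x))
        (name (W.erase (E.s (x.edge a))) (n - (b + 1)) (E.shift^[b + 1] x)) := by
  by_cases hex : ∃ i, i < n ∧ E.s (x.edge i) ∈ W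
  swap
  · left
    funext i
    rw [name, if_neg fun h => hex ⟨i, h⟩]
  right
  have ha := Nat.find_spec hex
  have hmin : ∀ i < Nat.find hex, ¬ (i < n ∧ E.s (x.edge i) ∈ W) := fun i hi => Nat.find_min hex hi
  generalize Nat.find hex = a at ha hmin
  let P : ℕ → Prop := fun i => E.s (x.edge i) = E.s (x.edge a)
  have hab : a ≤ Nat.findGreatest P (n - 1) := Nat.le_findGreatest (by omega) rfl
  have hPb : P (Nat.findGreatest P (n - 1)) :=
    Nat.findGreatest_spec (P := P) (m := a) (by omega) rfl
  have hbn : Nat.findGreatest P (n - 1) ≤ n - 1 := Nat.findGreatest_le _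
  have hmax : ∀ i, Nat.findGreatest P (n - 1) < i → i ≤ n - 1 → ¬ P i := fun i hi hi' =>
    Nat.findGreatest_is_greatest hi hi'
  generalize Nat.findGreatest P (n - 1) = b at hab hPb hbn hmax
  refine ⟨a, b, hab, by omega, ha.2, hPb, funext fun i => ?_⟩
  rw [splice]
  split_ifs with h1 h2 h3
  · rw [name, if_neg (hmin i h1)]
  · exact (name_shift_apply x (by omega) (by omega)).symm
  · subst h3
    exact name_of_mem (by omega) (by rw [hPb]; exact ha.2)
  · have he : (E.shift^[b + 1] x).edge (i - (b + 1)) = x.edge i := by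
      rw [shift_iterate_edge, show b + 1 + (i - (b + 1)) = i by omega]
    refine name_congr he.symm ?_
    rw [he, Finset.mem_erase]
    have h5 : i < n → E.s (x.edge i) ≠ E.s (x.edge a) := fun hi => hmax i (by omega) (by omega)
    constructor
    · exact fun h => ⟨by omega, h5 h.1, h.2⟩
    · exact fun h => ⟨by omega, h.2.2⟩

open Classical in
-- Induction on the size of `W`, with the constants taken from the fixed `W₀` and `F` so that they
-- survive the passage to a smaller set. A nonblank name is given by `(u, e, a, b)`, a loop name and
-- a shorter name; the two exponentials multiply to at most `exp (c * n)` because the two lengths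
-- add up to at most `n`.
theorem card_image_name_le {c : ℝ} (hc : 0 ≤ c)
    (hloop : ∀ (W : Finset V) (u : V) (n : ℕ) (T : Finset E.InfPath),
      (∀ x ∈ T, E.s (x.edge 0) = u ∧ E.s (x.edge n) = u) →
      ((T.image (name W n)).card : ℝ) ≤ Real.exp (c * n))
    (W₀ : Finset V) (F : Finset Ed) (hF : ∀ e, E.s e ∈ W₀ → e ∈ F) (k : ℕ) :
    ∀ W ⊆ W₀, W.card = k → ∀ (n : ℕ) (T : Finset E.InfPath),
      ((T.image (name W n)).card : ℝ) ≤
        ((1 + W₀.card * F.card) * ((n : ℝ) + 1) ^ 2) ^ k * Real.exp (c * n) := by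
  induction k with
  | zero =>
    intro W _ hW n T
    rw [Finset.card_eq_zero] at hW
    subst hW
    have h : T.image (name (E := E) ∅ n) ⊆ {fun _ => none} := by
      intro w hw
      obtain ⟨x, -, rfl⟩ := Finset.mem_image.1 hw
      exact Finset.mem_singleton.2 (funext fun i => by simp [name])
    have h1 : ((T.image (name (E := E) ∅ n)).card : ℝ) ≤ 1 := by
      exact_mod_cast (Finset.card_le_card h).trans (Finset.card_singleton _).le
    refine h1.trans ?_
    rw [pow_zero, one_mul]
    exact Real.one_le_exp (by positivity)
  | succ k ih =>
    intro W hWW hW n T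
    let D : ℝ := 1 + W₀.card * F.card
    let A : ℝ := (D * ((n : ℝ) + 1) ^ 2) ^ k * Real.exp (c * n)
    let I : Finset ((V × Ed) × ℕ × ℕ) := (W ×ˢ F) ×ˢ (Finset.range n ×ˢ Finset.range n)
    let B (q : (V × Ed) × ℕ × ℕ) : Finset (ℕ → Option Ed) :=
      ((((T.filter fun x => q.2.1 ≤ q.2.2 ∧ E.s (x.edge q.2.1) = q.1.1 ∧
            E.s (x.edge q.2.2) = q.1.1).image E.shift^[q.2.1]).image
          (name W (q.2.2 - q.2.1))) ×ˢ
        ((T.image E.shift^[q.2.2 + 1]).image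
          (name (W.erase q.1.1) (n - (q.2.2 + 1))))).image
        fun wv => splice q.2.1 q.2.2 q.1.2 wv.1 wv.2
    have hD : 1 ≤ D := le_add_of_nonneg_right (by positivity)
    have hbase : 1 ≤ D * ((n : ℝ) + 1) ^ 2 :=
      one_le_mul_of_one_le_of_one_le hD (one_le_pow₀ (by linarith [n.cast_nonneg (α := ℝ)]))
    have hA : 1 ≤ A :=
      one_le_mul_of_one_le_of_one_le (one_le_pow₀ hbase) (Real.one_le_exp (by positivity))
    have hsub : T.image (name W n) ⊆ insert (fun _ => none) (I.biUnion B) := by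
      intro w hw
      obtain ⟨x, hx, rfl⟩ := Finset.mem_image.1 hw
      rcases name_eq_blank_or_splice W n x with h | ⟨a, b, hab, hbn, haW, hba, h⟩
      · exact Finset.mem_insert.2 (Or.inl h)
      · refine Finset.mem_insert_of_mem (Finset.mem_biUnion.2
          ⟨((E.s (x.edge a), x.edge b), a, b), ?_, ?_⟩)
        · simp only [I, Finset.mem_product, Finset.mem_range]
          refine ⟨⟨haW, hF _ ?_⟩, by omega, hbn⟩
          rw [hba]
          exact hWW haW
        · rw [h]
          refine Finset.mem_image.2 ⟨(_, _), Finset.mem_product.2 ⟨?_, ?_⟩, rfl⟩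
          · exact Finset.mem_image_of_mem _ (Finset.mem_image_of_mem _
              (Finset.mem_filter.2 ⟨hx, hab, rfl, hba⟩))
          · exact Finset.mem_image_of_mem _ (Finset.mem_image_of_mem _ hx)
    have hB : ∀ q ∈ I, ((B q).card : ℝ) ≤ A := by
      rintro ⟨⟨u, e⟩, a, b⟩ hq
      simp only [I, Finset.mem_product, Finset.mem_range] at hq
      obtain ⟨⟨hu, -⟩, -, hbn⟩ := hq
      by_cases hab : a ≤ b
      swap
      · have : B ((u, e), a, b) = ∅ := by simp [B, hab]
        rw [this, Finset.card_empty, Nat.cast_zero]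
        linarith
      have h1 := hloop W u (b - a) ((T.filter fun x => a ≤ b ∧ E.s (x.edge a) = u ∧
            E.s (x.edge b) = u).image E.shift^[a]) (by
        intro y hy
        obtain ⟨x, hx, rfl⟩ := Finset.mem_image.1 hy
        rw [shift_iterate_edge, shift_iterate_edge, add_zero, Nat.add_sub_cancel' hab]
        exact (Finset.mem_filter.1 hx).2.2)
      have h2 := ih (W.erase u) ((W.erase_subset u).trans hWW)
        (by rw [Finset.card_erase_of_mem hu, hW, Nat.add_sub_cancel]) (n - (b + 1))
        (T.image E.shift^[b + 1])
      have h3 : ((B ((u, e), a, b)).card : ℝ) ≤ _ :=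
        (Nat.cast_le.2 (Finset.card_image_le.trans (Finset.card_product _ _).le))
      rw [Nat.cast_mul] at h3
      refine h3.trans ((mul_le_mul h1 h2 (by positivity) (by positivity)).trans ?_)
      have h4 : ((n - (b + 1) : ℕ) : ℝ) ≤ n := Nat.cast_le.2 (Nat.sub_le _ _)
      have h5 : ((b - a : ℕ) : ℝ) + ((n - (b + 1) : ℕ) : ℝ) ≤ n := by
        exact_mod_cast (by omega : (b - a) + (n - (b + 1)) ≤ n)
      calc _ = ((1 + W₀.card * F.card) * (((n - (b + 1) : ℕ) : ℝ) + 1) ^ 2) ^ k *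
            Real.exp (c * (((b - a : ℕ) : ℝ) + ((n - (b + 1) : ℕ) : ℝ))) := by
              rw [mul_add, Real.exp_add]; ring
        _ ≤ A := by
              simp only [A, D]
              gcongr
    have hcard : ((T.image (name W n)).card : ℝ) ≤ I.card * A + 1 := by
      have h1 := (Finset.card_le_card hsub).trans (Finset.card_insert_le _ _)
      have h2 : ((I.biUnion B).card : ℝ) ≤ I.card * A := by
        calc ((I.biUnion B).card : ℝ) ≤ ∑ q ∈ I, ((B q).card : ℝ) := by
              exact_mod_cast Finset.card_biUnion_le
          _ ≤ ∑ q ∈ I, A := Finset.sum_le_sum hB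
          _ = I.card * A := by rw [Finset.sum_const, nsmul_eq_mul]
      have h3 : ((T.image (name W n)).card : ℝ) ≤ (I.biUnion B).card + 1 := by exact_mod_cast h1
      linarith
    have hI : (I.card : ℝ) ≤ (W₀.card * F.card) * (n : ℝ) ^ 2 := by
      simp only [I, Finset.card_product, Finset.card_range]
      have := Finset.card_le_card hWW
      push_cast
      rw [← sq]
      gcongr
    calc ((T.image (name W n)).card : ℝ) ≤ I.card * A + 1 := hcard
      _ ≤ ((W₀.card * F.card) * (n : ℝ) ^ 2) * A + A := by gcongr
      _ = ((W₀.card * F.card) * (n : ℝ) ^ 2 + 1) * A := by ring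
      _ ≤ (D * ((n : ℝ) + 1) ^ 2) * A := by
        gcongr
        have hn : (0 : ℝ) ≤ n := n.cast_nonneg
        have hw : (0 : ℝ) ≤ W₀.card * F.card := by positivity
        simp only [D]
        nlinarith [mul_nonneg hw hn]
      _ = _ := by simp only [A, D]; ring

/-! ### The upper bound -/

theorem card_image_name_loops_le [DecidableEq (ℕ → Option Ed)] {c : ℝ}
    (hc : E.gurevichEntropy = (c : EReal)) (W : Finset V)
    (u : V) (n : ℕ) (T : Finset E.InfPath)
    (hT : ∀ x ∈ T, E.s (x.edge 0) = u ∧ E.s (x.edge n) = u) :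
    ((T.image (name W n)).card : ℝ) ≤ Real.exp (c * n) := by
  classical
  rcases n.eq_zero_or_pos with rfl | hn
  · have h : T.image (name (E := E) W 0) ⊆ {fun _ => none} := by
      intro w hw
      obtain ⟨x, -, rfl⟩ := Finset.mem_image.1 hw
      exact Finset.mem_singleton.2 (funext fun i => by simp [name])
    have h1 : ((T.image (name (E := E) W 0)).card : ℝ) ≤ 1 := by
      exact_mod_cast (Finset.card_le_card h).trans (Finset.card_singleton _).le
    simpa using h1
  -- One representative per name: distinct representatives have distinct names, hence differ in
  -- their first `n` edges, as `log_card_loops_le` requires.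
  obtain ⟨T', hT', hinj, him⟩ := Finset.exists_subset_injOn_image_eq_of_surjOn
    (f := name (E := E) W n) (T : Set E.InfPath) (T.image (name W n)) (by
      rw [Finset.coe_image]
      exact Set.surjOn_image _ _)
  rw [← him, Finset.card_image_of_injOn hinj]
  rcases Nat.eq_zero_or_pos T'.card with h0 | hpos
  · rw [h0, Nat.cast_zero]
    positivity
  have h := log_card_loops_le hn T' (fun x hx => hT x (hT' hx)) fun x hx y hy hxy =>
    hinj hx hy (name_eq_of_edge_eq W hxy)
  have hpos' : (0 : ℝ) < T'.card := by exact_mod_cast hpos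
  rw [hc, ← ENNReal.ofReal_natCast, ENNReal.log_ofReal_of_pos hpos', ← EReal.coe_coe_eq_natCast,
    ← EReal.coe_div, EReal.coe_le_coe_iff, div_le_iff₀ (by exact_mod_cast hn)] at h
  rwa [← Real.log_le_iff_le_exp hpos']

/-- Paths with the same name, relative to a large finite set of vertices, are close. -/
def NamesControl (E : DiGraph V Ed) (d : E.InfPath → E.InfPath → ℝ) : Prop :=
  ∀ ε > 0, ∃ (W : Finset V) (L : ℕ), ∀ x y : E.InfPath, name W L x = name W L y → d x y ≤ ε

/-- The polynomial factor and the shift by `L` disappear in the exponential growth rate. -/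
theorem tendsto_log_poly_mul_exp {D : ℝ} (hD : 0 < D) (c : ℝ) (k L : ℕ) :
    Tendsto (fun n : ℕ => Real.log ((D * (((n + L : ℕ) : ℝ) + 1) ^ 2) ^ k *
      Real.exp (c * (n + L : ℕ))) / n) atTop (𝓝 c) := by
  have h0 : Tendsto (fun n : ℕ => ((n : ℝ))⁻¹) atTop (𝓝 0) := tendsto_inv_atTop_nhds_zero_nat
  have hm : Tendsto (fun n : ℕ => ((n + L : ℕ) : ℝ) + 1) atTop atTop :=
    tendsto_atTop_add_const_right _ _
      (tendsto_natCast_atTop_atTop.comp (tendsto_add_atTop_nat L))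
  have h1 : Tendsto (fun n : ℕ => Real.log (((n + L : ℕ) : ℝ) + 1) / (((n + L : ℕ) : ℝ) + 1))
      atTop (𝓝 0) := (Real.isLittleO_log_id_atTop.tendsto_div_nhds_zero).comp hm
  have h2 : Tendsto (fun n : ℕ => k * Real.log D * ((n : ℝ))⁻¹ +
      2 * k * (Real.log (((n + L : ℕ) : ℝ) + 1) / (((n + L : ℕ) : ℝ) + 1)) *
        (1 + (L + 1) * ((n : ℝ))⁻¹) + c * (1 + L * ((n : ℝ))⁻¹)) atTop (𝓝 c) := by
    have := ((h0.const_mul (k * Real.log D)).add ((h1.const_mul (2 * (k : ℝ))).mul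
      ((h0.const_mul ((L : ℝ) + 1)).const_add 1))).add
      (((h0.const_mul (L : ℝ)).const_add 1).const_mul c)
    simpa using this
  refine h2.congr' ?_
  filter_upwards [eventually_gt_atTop 0] with n hn
  have hn' : (n : ℝ) ≠ 0 := by exact_mod_cast hn.ne'
  have hpos : (0 : ℝ) < ((n + L : ℕ) : ℝ) + 1 := by positivity
  rw [Real.log_mul (by positivity) (by positivity), Real.log_exp, Real.log_pow,
    Real.log_mul hD.ne' (by positivity), Real.log_pow]
  have hpos' := hpos.ne'
  push_cast at hpos' ⊢
  field_simp
  ring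

theorem metricEntropy_le_gurevichEntropy (hE : E.RowFinite) {d : E.InfPath → E.InfPath → ℝ}
    (hd : E.NamesControl d) : (E.edgeShift hE).metricEntropy d ≤ E.gurevichEntropy := by
  classical
  rcases eq_or_ne E.gurevichEntropy ⊤ with htop | htop
  · rw [htop]
    exact le_top
  obtain ⟨c, hc⟩ : ∃ c : ℝ, E.gurevichEntropy = (c : EReal) :=
    ⟨_, (EReal.coe_toReal htop (ne_bot_of_le_ne_bot EReal.zero_ne_bot gurevichEntropy_nonneg)).symm⟩
  have hc0 : 0 ≤ c := by
    have := gurevichEntropy_nonneg (E := E)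
    rw [hc] at this
    exact_mod_cast this
  refine iSup₂_le fun K _ => iSup₂_le fun ε hε => ?_
  obtain ⟨W, L, hWL⟩ := hd ε hε
  let F : Finset Ed := W.biUnion fun v => (hE v).toFinset
  have hF : ∀ e, E.s e ∈ W → e ∈ F := fun e he =>
    Finset.mem_biUnion.2 ⟨E.s e, he, by simp⟩
  let b (n : ℕ) : ℝ := ((1 + W.card * F.card) * (((n + L : ℕ) : ℝ) + 1) ^ 2) ^ W.card *
    Real.exp (c * (n + L : ℕ))
  have hbpos : ∀ n, 0 < b n := fun n => by positivity
  have hcard : ∀ (n : ℕ) (T : Finset E.InfPath),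
      ((T.image (name W (n + L))).card : ℝ) ≤ b n := fun n T =>
    card_image_name_le hc0 (fun W u n T hT => card_image_name_loops_le hc W u n T hT) W F hF
      W.card W subset_rfl rfl (n + L) T
  have hssep : ∀ n, (E.edgeShift hE).ssep d n ε K ≤ (⌊b n⌋₊ : ℕ∞) := by
    intro n
    rw [ssep_edgeShift]
    refine iSup₂_le fun A hA => ?_
    -- Distances at times before `n` depend on windows of length `L`, all contained in the name of
    -- length `n + L`; separated paths therefore have different names.
    have hT : ∀ T : Finset E.InfPath, (T : Set E.InfPath) ⊆ A → T.card ≤ ⌊b n⌋₊ := by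
      intro T hTA
      have hinj : Set.InjOn (name W (n + L)) (T : Set E.InfPath) := by
        intro x hx y hy hxy
        by_contra hne
        obtain ⟨i, hi, hlt⟩ := (lt_distIter_iff hE hε.le n x y).1 (hA.2 x (hTA hx) y (hTA hy) hne)
        exact hlt.not_ge (hWL _ _ (name_shift_eq hi hxy))
      rw [← Finset.card_image_of_injOn hinj]
      exact Nat.le_floor (hcard n T)
    by_contra! hlt
    -- `A` may be infinite a priori, so a finite subset of size one too large is extracted.
    obtain ⟨t, htA, htc⟩ := Set.exists_subset_encard_eq (Order.add_one_le_of_lt hlt)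
    have htfin : t.Finite := Set.finite_of_encard_eq_coe (k := ⌊b n⌋₊ + 1) (by rw [htc]; rfl)
    have h1 := hT htfin.toFinset (by simpa using htA)
    rw [htfin.encard_eq_coe_toFinset_card] at htc
    have h2 : htfin.toFinset.card = ⌊b n⌋₊ + 1 := by exact_mod_cast htc
    omega
  have hle : ∀ n : ℕ, ENNReal.log ((E.edgeShift hE).ssep d n ε K : ENNReal) / (n : EReal) ≤
      ((Real.log (b n) / n : ℝ) : EReal) := by
    intro n
    rw [EReal.coe_div, EReal.coe_coe_eq_natCast, ← ENNReal.log_ofReal_of_pos (hbpos n)]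
    refine EReal.div_le_div_right_of_nonneg (by positivity) (ENNReal.log_monotone ?_)
    refine (ENat.toENNReal_mono (hssep n)).trans ?_
    rw [ENat.toENNReal_coe, ← ENNReal.ofReal_natCast]
    exact ENNReal.ofReal_le_ofReal (Nat.floor_le (hbpos n).le)
  refine (limsup_le_limsup (Eventually.of_forall hle)).trans ?_
  have hlim := tendsto_log_poly_mul_exp (D := 1 + W.card * F.card) (by positivity) c W.card L
  rw [hc]
  exact ((continuous_coe_real_ereal.tendsto c).comp hlim).limsup_eq.le

/-! ### The path metric -/

/-- The initial segment of length `n + 1` of an infinite path. -/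
def initialPath (n : ℕ) (x : E.InfPath) : E.FinPath :=
  .ofEdges (List.ofFn fun i : Fin (n + 1) => x.edge i) (by simp) (by
    rw [List.isChain_iff_getElem]
    intro i hi
    simpa [-List.ofFn_succ] using x.chain i)

theorem isInitial_initialPath {n : ℕ} {x y : E.InfPath} :
    E.IsInitial (initialPath n x) y ↔ ∀ i < n + 1, x.edge i = y.edge i := by
  simp [initialPath, IsInitial, -List.ofFn_succ]

theorem exists_xor_isInitial (p : ℕ ≃ E.FinPath) {x y : E.InfPath} {n : ℕ}
    (hn : ∃ i < n + 1, x.edge i ≠ y.edge i) :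
    Xor (E.IsInitial (p (p.symm (initialPath n x))) x)
      (E.IsInitial (p (p.symm (initialPath n x))) y) := by
  rw [p.apply_symm_apply, isInitial_initialPath, isInitial_initialPath]
  left
  push Not
  exact ⟨fun i _ => rfl, hn⟩

theorem separatesPrefixes_pathDist (p : ℕ ≃ E.FinPath) : E.SeparatesPrefixes (E.pathDist p) := by
  intro H L
  let restr (x : E.InfPath) : Fin (L + 1) → Ed := fun i => x.edge i
  -- The index of the initial path depends only on the prefix, and the prefixes in `H` are finite in
  -- number; `M` bounds all their indices.
  have hM : ∀ r, ∃ m, ∀ x, restr x = r → p.symm (initialPath L x) ≤ m := by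
    intro r
    by_cases hr : ∃ x, restr x = r
    · obtain ⟨x, rfl⟩ := hr
      refine ⟨p.symm (initialPath L x), fun y hy => le_of_eq (congrArg p.symm ?_)⟩
      simp only [initialPath]
      congr 2
    · exact ⟨0, fun x hx => absurd ⟨x, hx⟩ hr⟩
  choose m hm using hM
  let M := (Fintype.piFinset fun _ : Fin (L + 1) => H.edges).sup m
  -- The first distinguishing index is at most `M`, so the distance is at least `1 / 2 ^ (M + 1)`;
  -- one more factor of two makes the inequality strict.
  refine ⟨1 / 2 ^ (M + 2), by positivity, fun x hx y hy ⟨i, hi, hne⟩ => ?_⟩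
  have hxor := exists_xor_isInitial p (n := L) ⟨i, by omega, hne⟩
  have hxy : x ≠ y := fun h => hne (by rw [h])
  rw [pathDist, if_neg hxy]
  have h1 : p.symm (initialPath L x) ≤ M := (hm _ x rfl).trans
    (Finset.le_sup (f := m) (Fintype.mem_piFinset.2 fun j => hx j))
  have h2 := (Nat.sInf_le (s := {i | Xor (E.IsInitial (p i) x) (E.IsInitial (p i) y)})
    hxor).trans h1
  refine one_div_lt_one_div_of_lt (by positivity) (pow_lt_pow_right₀ (by norm_num) (by omega))

/-- A finite path involves finitely many source vertices; once these are in `W`, the name records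
every edge that has to be compared. -/
theorem exists_isInitial_of_name_eq (q : E.FinPath) : ∃ (W : Finset V) (L : ℕ),
    ∀ x y : E.InfPath, name W L x = name W L y → E.IsInitial q x → E.IsInitial q y := by
  classical
  cases q with
  | ofVertices A hA =>
    refine ⟨A, 1, fun x y h hx => ?_⟩
    have hx' : E.s (x.edge 0) ∈ A := hx
    change E.s (y.edge 0) ∈ A
    rwa [edge_eq_of_name_eq h one_pos hx']
  | ofEdges l hne hl =>
    refine ⟨l.toFinset.image E.s, l.length, fun x y h hx i hi => ?_⟩
    have hxi : l[i] = x.edge i := hx i hi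
    rw [edge_eq_of_name_eq h hi, hxi]
    rw [← hxi]
    exact Finset.mem_image_of_mem _ (List.mem_toFinset.2 (List.getElem_mem hi))

theorem namesControl_pathDist (p : ℕ ≃ E.FinPath) : E.NamesControl (E.pathDist p) := by
  classical
  intro ε hε
  obtain ⟨N, hN⟩ := exists_pow_lt_of_lt_one hε (by norm_num : (1 / 2 : ℝ) < 1)
  choose W L hWL using fun q : E.FinPath => exists_isInitial_of_name_eq q
  refine ⟨(Finset.range N).biUnion fun i => W (p i), (Finset.range N).sup fun i => L (p i),
    fun x y hxy => ?_⟩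
  rw [pathDist]
  split_ifs with h
  · exact hε.le
  obtain ⟨k, hk⟩ : ∃ k, x.edge k ≠ y.edge k := by
    by_contra! hcon
    exact h (InfPath.ext (funext hcon))
  -- Distinct paths are told apart by some initial path, so the infimum is attained and is not the
  -- default `0` of an empty set.
  have hmem := Nat.sInf_mem (s := {i | Xor (E.IsInitial (p i) x) (E.IsInitial (p i) y)})
    ⟨_, exists_xor_isInitial p (n := k) ⟨k, k.lt_succ_self, hk⟩⟩
  have hge : N ≤ sInf {i | Xor (E.IsInitial (p i) x) (E.IsInitial (p i) y)} := by
    by_contra! hlt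
    generalize sInf {i | Xor (E.IsInitial (p i) x) (E.IsInitial (p i) y)} = j at hmem hlt
    have hj := Finset.mem_range.2 hlt
    have hname := name_eq_mono (Finset.subset_biUnion_of_mem (fun i => W (p i)) hj)
      (Finset.le_sup (f := fun i => L (p i)) hj) hxy
    rcases hmem with ⟨h1, h2⟩ | ⟨h1, h2⟩
    · exact h2 (hWL _ _ _ hname h1)
    · exact h2 (hWL _ _ _ hname.symm h1)
  rw [← one_div_pow]
  exact (pow_le_pow_of_le_one (by norm_num) (by norm_num) (by omega)).trans hN.le

/-! ### Gurevich's metric -/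

theorem abs_inv_sub_inv_le_one (a b : ℕ) : |1 / ((a : ℝ) + 1) - 1 / ((b : ℝ) + 1)| ≤ 1 := by
  have h : ∀ a : ℕ, 0 < 1 / ((a : ℝ) + 1) ∧ 1 / ((a : ℝ) + 1) ≤ 1 := fun a =>
    ⟨Nat.one_div_pos_of_nat, div_le_one_of_le₀ (by linarith [a.cast_nonneg (α := ℝ)])
      (by positivity)⟩
  rw [abs_le]
  constructor <;> linarith [h a, h b]

theorem summable_gurevichDist (h : Ed ↪ ℕ) (x y : E.InfPath) :
    Summable fun i : ℕ =>
      |1 / ((h (x.edge i) : ℝ) + 1) - 1 / ((h (y.edge i) : ℝ) + 1)| / 2 ^ (i + 1) := by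
  refine Summable.of_nonneg_of_le (fun i => by positivity) (fun i => ?_)
    ((summable_nat_add_iff 1).2 summable_geometric_two)
  rw [one_div_pow]
  exact div_le_div_of_nonneg_right (abs_inv_sub_inv_le_one _ _) (by positivity)

theorem separatesPrefixes_gurevichDist (h : Ed ↪ ℕ) :
    E.SeparatesPrefixes (E.gurevichDist h) := by
  intro H L
  let M := H.edges.sup h
  -- A single term suffices: the reciprocals of distinct numbers up to `M + 1` differ by at least `1
  -- / (M + 1) ^ 2`, and `i < L` makes the weight strictly larger than `1 / 2 ^ (L + 1)`.
  refine ⟨1 / (((M : ℝ) + 1) ^ 2 * 2 ^ (L + 1)), by positivity, fun x hx y hy ⟨i, hi, hne⟩ => ?_⟩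
  have hterm := (summable_gurevichDist h x y).le_tsum i fun j _ => by positivity
  refine lt_of_lt_of_le ?_ hterm
  have hxM : (h (x.edge i) : ℝ) ≤ M := by exact_mod_cast Finset.le_sup (f := h) (hx i)
  have hyM : (h (y.edge i) : ℝ) ≤ M := by exact_mod_cast Finset.le_sup (f := h) (hy i)
  have hxy : (1 : ℝ) ≤ |(h (y.edge i) : ℝ) - h (x.edge i)| := by
    have h1 : (h (y.edge i) : ℤ) - h (x.edge i) ≠ 0 := by
      rw [sub_ne_zero]
      exact fun h2 => hne (h.injective (by exact_mod_cast h2.symm))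
    exact_mod_cast Int.one_le_abs h1
  have hx1 : (0 : ℝ) < (h (x.edge i) : ℝ) + 1 := by positivity
  have hy1 : (0 : ℝ) < (h (y.edge i) : ℝ) + 1 := by positivity
  rw [div_sub_div _ _ hx1.ne' hy1.ne', abs_div, abs_of_pos (mul_pos hx1 hy1), div_div,
    show (1 * ((h (y.edge i) : ℝ) + 1) - ((h (x.edge i) : ℝ) + 1) * 1) =
      h (y.edge i) - h (x.edge i) by ring]
  have h2 : ((h (x.edge i) : ℝ) + 1) * (h (y.edge i) + 1) * 2 ^ (i + 1) <
      ((M : ℝ) + 1) ^ 2 * 2 ^ (L + 1) := by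
    rw [sq]
    refine mul_lt_mul' (by gcongr) (pow_lt_pow_right₀ (by norm_num) (by omega)) (by positivity)
      (by positivity)
  calc 1 / (((M : ℝ) + 1) ^ 2 * 2 ^ (L + 1)) < 1 / (((h (x.edge i) : ℝ) + 1) *
        (h (y.edge i) + 1) * 2 ^ (i + 1)) := one_div_lt_one_div_of_lt (by positivity) h2
    _ ≤ _ := by gcongr

/-- All but finitely many edges have a reciprocal of at most `ε / 2`. With the sources of the
exceptional edges in `W`, equal names force each early coordinate either to agree or to have two
small reciprocals; the tail is at most `(1 / 2) ^ L`. -/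
theorem namesControl_gurevichDist (h : Ed ↪ ℕ) : E.NamesControl (E.gurevichDist h) := by
  classical
  intro ε hε
  obtain ⟨L, hL⟩ := exists_pow_lt_of_lt_one (half_pos hε) (by norm_num : (1 / 2 : ℝ) < 1)
  obtain ⟨m, hm⟩ := exists_nat_one_div_lt (half_pos hε)
  have hfin : {e | h e < m}.Finite := (finite_lt_nat m).preimage h.injective.injOn
  refine ⟨hfin.toFinset.image E.s, L, fun x y hxy => ?_⟩
  have hmem : ∀ e, h e < m → E.s e ∈ hfin.toFinset.image E.s := fun e he =>
    Finset.mem_image_of_mem _ (by simpa using he)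
  have hinv : ∀ e, ¬ h e < m → 0 < 1 / ((h e : ℝ) + 1) ∧ 1 / ((h e : ℝ) + 1) ≤ ε / 2 := by
    intro e he
    refine ⟨Nat.one_div_pos_of_nat, (one_div_le_one_div_of_le (by positivity) ?_).trans hm.le⟩
    have : (m : ℝ) ≤ h e := by exact_mod_cast not_lt.1 he
    linarith
  have hfirst : ∀ i < L, |1 / ((h (x.edge i) : ℝ) + 1) - 1 / ((h (y.edge i) : ℝ) + 1)| ≤ ε / 2 := by
    intro i hi
    by_cases hx : h (x.edge i) < m
    · rw [edge_eq_of_name_eq hxy hi (hmem _ hx), sub_self, abs_zero]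
      positivity
    by_cases hy : h (y.edge i) < m
    · rw [edge_eq_of_name_eq hxy.symm hi (hmem _ hy), sub_self, abs_zero]
      positivity
    rw [abs_le]
    constructor <;> linarith [hinv _ hx, hinv _ hy]
  have hgeo : Summable fun i : ℕ => (1 : ℝ) / 2 ^ (i + 1) := by
    simpa only [one_div_pow] using (summable_nat_add_iff 1).2 summable_geometric_two
  have hgeo1 : ∑' i : ℕ, (1 : ℝ) / 2 ^ (i + 1) = 1 := by
    have h1 : ∀ i : ℕ, (1 : ℝ) / 2 ^ (i + 1) = 1 / 2 * (1 / 2) ^ i := fun i => by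
      rw [← one_div_pow, pow_succ']
    simp_rw [h1]
    rw [tsum_mul_left, tsum_geometric_two]
    norm_num
  rw [gurevichDist, ← (summable_gurevichDist h x y).sum_add_tsum_nat_add L]
  have hA : ∑ i ∈ Finset.range L, |1 / ((h (x.edge i) : ℝ) + 1) - 1 / ((h (y.edge i) : ℝ) + 1)| /
      2 ^ (i + 1) ≤ ε / 2 := by
    calc _ ≤ ∑ i ∈ Finset.range L, ε / 2 * (1 / 2 ^ (i + 1)) := by
          refine Finset.sum_le_sum fun i hi => ?_
          rw [mul_one_div]
          exact div_le_div_of_nonneg_right (hfirst i (Finset.mem_range.1 hi)) (by positivity)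
      _ = ε / 2 * ∑ i ∈ Finset.range L, 1 / 2 ^ (i + 1) := by rw [Finset.mul_sum]
      _ ≤ ε / 2 * 1 := by
          refine mul_le_mul_of_nonneg_left ?_ (by positivity)
          exact (hgeo.sum_le_tsum _ fun i _ => by positivity).trans hgeo1.le
      _ = ε / 2 := mul_one _
  have hB : ∑' i : ℕ, |1 / ((h (x.edge (i + L)) : ℝ) + 1) - 1 / ((h (y.edge (i + L)) : ℝ) + 1)| /
      2 ^ (i + L + 1) ≤ ε / 2 := by
    calc _ ≤ ∑' i : ℕ, (1 / 2 : ℝ) ^ L * (1 / 2 ^ (i + 1)) := by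
          refine Summable.tsum_le_tsum (fun i => ?_)
            ((summable_nat_add_iff L).2 (summable_gurevichDist h x y)) (hgeo.mul_left _)
          have : (1 / 2 : ℝ) ^ L * (1 / 2 ^ (i + 1)) = 1 / 2 ^ (i + L + 1) := by
            simp only [← one_div_pow, ← pow_add]
            congr 1
            omega
          rw [this]
          exact div_le_div_of_nonneg_right (abs_inv_sub_inv_le_one _ _) (by positivity)
      _ = (1 / 2) ^ L := by rw [tsum_mul_left, hgeo1, mul_one]
      _ ≤ ε / 2 := hL.le
  linarith

end DiGraph

end GraphEntropy

theorem mainTheorem5 {V Ed : Type*} [Countable V] [Countable Ed] [Nonempty V]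
    (E : GraphEntropy.DiGraph V Ed) (hsink : E.NoSinks) (hE : E.LocallyFinite)
    (p : ℕ ≃ E.FinPath) (h : Ed ↪ ℕ) :
    (E.edgeShift hE.1).metricEntropy (E.pathDist p) = E.gurevichEntropy ∧
      (E.edgeShift hE.1).metricEntropy (E.gurevichDist h) = E.gurevichEntropy := by
  have := GraphEntropy.DiGraph.exists_infPath hsink
  open GraphEntropy.DiGraph in
  exact ⟨(metricEntropy_le_gurevichEntropy hE.1 (namesControl_pathDist p)).antisymm
      (gurevichEntropy_le_metricEntropy hE.1 (separatesPrefixes_pathDist p)),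
    (metricEntropy_le_gurevichEntropy hE.1 (namesControl_gurevichDist h)).antisymm
      (gurevichEntropy_le_metricEntropy hE.1 (separatesPrefixes_gurevichDist h))⟩
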